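/- Let $n\ge 2$ and $s\ge 0$ be integers and let $q_n=x_1^2+\cdots+x_n^2\in\mathbb{C}[x_1,\dots,x_n]$. Let $\mathbb{C}[y_1,\dots,y_n]$ act on $\mathbb{C}[x_1,\dots,x_n]$ by differentiation (the apolarity action): $\circ$ is the bilinear map with $\mathbf{y}^{\boldsymbol\alpha}\circ f=\dfrac{\partial^{|\boldsymbol\alpha|}f}{\partial\mathbf{x}^{\boldsymbol\alpha}}$ for every multi-index $\boldsymbol\alpha\in\mathbb{N}^n$. For $f\in\mathbb{C}[x_1,\dots,x_n]$ let $$\mathrm{Ann}(f)=\{g\in\mathbb{C}[y_1,\dots,y_n] : g\circ f=0\}$$ be its apolar ideal, and let $\mathcal{H}_{n,d}$ be the space of harmonic polynomials of degree $d$, that is, of the homogeneous polynomials $h$ of degree $d$ in $n$ variables, with complex coefficients, such that $\Delta h=\sum_{i=1}^n\partial_i^2h=0$; here $\mathcal{H}_{n,d}$ is regarded as a subspace of $\mathbb{C}[y_1,\dots,y_n]$ by renaming $x_i$ to $y_i$. Then $\mathrm{Ann}(q_n^s)$ is the ideal of $\mathbb{C}[y_1,\dots,y_n]$ generated by $\mathcal{H}_{n,s+1}$: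 $$\mathrm{Ann}(q_n^s)=(\mathcal{H}_{n,s+1}).$$ -/

import Mathlib

noncomputable section

namespace Apolarity

open MvPolynomial

/-- The quadratic form `q_n = x_1 ^ 2 + ⋯ + x_n ^ 2` in `ℂ[x_1, …, x_n]`. -/
def quadric (n : ℕ) : MvPolynomial (Fin n) ℂ := ∑ i, X i ^ 2

theorem commute_pderiv (n : ℕ) (i j : Fin n) :
    Commute ((pderiv i).toLinearMap : Module.End ℂ (MvPolynomial (Fin n) ℂ))
      (pderiv j).toLinearMap := by
  let D : Fin n → Derivation ℂ (MvPolynomial (Fin n) ℂ) (MvPolynomial (Fin n) ℂ) :=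
    fun i => pderiv i
  have h : ⁅D i, D j⁆ = 0 := by
    apply MvPolynomial.derivation_ext
    intro k
    simp only [D, Derivation.commutator_apply, pderiv_X, Pi.single_apply]
    split_ifs <;> simp
  refine LinearMap.ext fun p => ?_
  have hp := congrArg
    (fun E : Derivation ℂ (MvPolynomial (Fin n) ℂ) (MvPolynomial (Fin n) ℂ) => E p) h
  simp only [Derivation.commutator_apply, Derivation.coe_zero, Pi.zero_apply] at hp
  exact sub_eq_zero.mp hp

theorem pairwise_commute_pderiv_pow (n : ℕ) (α β : Fin n → ℕ) :
    ((Finset.univ : Finset (Fin n)) : Set (Fin n)).Pairwise fun i j =>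
      Commute ((pderiv i).toLinearMap ^ α i : Module.End ℂ (MvPolynomial (Fin n) ℂ))
        ((pderiv j).toLinearMap ^ β j) :=
  fun i _ j _ _ => (commute_pderiv n i j).pow_pow _ _

/-- The iterated partial derivative `∂ ^ |α| / ∂x ^ α = ∏ i, (∂ / ∂x_i) ^ α_i`, as a linear
endomorphism of `ℂ[x_1, …, x_n]`.  The factors commute, so their order is immaterial. -/
def iteratedPartial {n : ℕ} (α : Fin n →₀ ℕ) : Module.End ℂ (MvPolynomial (Fin n) ℂ) :=
  Finset.univ.noncommProd (fun i => (pderiv i).toLinearMap ^ α i)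
    (pairwise_commute_pderiv_pow n α α)

/-- The apolarity action `φ ∘ f` of a polynomial differential operator `φ` on a polynomial `f`:
the monomial `y ^ α` acts as `∂ ^ |α| / ∂x ^ α`, extended linearly in `φ`.  The variables `y_i` of
the ring of operators and the variables `x_i` are both called `X i`. -/
def apolarAction {n : ℕ} (φ f : MvPolynomial (Fin n) ℂ) : MvPolynomial (Fin n) ℂ :=
  ∑ α ∈ φ.support, φ.coeff α • iteratedPartial α f

theorem iteratedPartial_zero {n : ℕ} :
    (iteratedPartial 0 : Module.End ℂ (MvPolynomial (Fin n) ℂ)) = 1 :=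
  (Finset.noncommProd_eq_pow_card _ _ _ 1 fun i _ => by simp).trans (one_pow _)

theorem iteratedPartial_add {n : ℕ} (α β : Fin n →₀ ℕ) :
    iteratedPartial (α + β) = iteratedPartial α * iteratedPartial β :=
  (Finset.noncommProd_congr rfl (fun i _ => by simp [pow_add]) _).trans
    (Finset.noncommProd_mul_distrib _ _ (pairwise_commute_pderiv_pow n α α)
      (pairwise_commute_pderiv_pow n β β) (pairwise_commute_pderiv_pow n β α))

/-- The apolarity action as an algebra homomorphism from operators to endomorphisms. -/
def apolarHom (n : ℕ) :
    MvPolynomial (Fin n) ℂ →ₐ[ℂ] Module.End ℂ (MvPolynomial (Fin n) ℂ) :=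
  AddMonoidAlgebra.lift ℂ (Module.End ℂ (MvPolynomial (Fin n) ℂ)) (Fin n →₀ ℕ)
    { toFun := fun α => iteratedPartial α.toAdd
      map_one' := iteratedPartial_zero
      map_mul' := fun α β => iteratedPartial_add α.toAdd β.toAdd }

theorem apolarHom_apply {n : ℕ} (φ f : MvPolynomial (Fin n) ℂ) :
    apolarHom n φ f = apolarAction φ f := by
  unfold apolarHom apolarAction
  rw [AddMonoidAlgebra.lift_apply, Finsupp.sum, LinearMap.sum_apply]
  rfl

/-- The apolar ideal `Ann(f) = {φ | φ ∘ f = 0}` of `f`. -/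
def apolarIdeal {n : ℕ} (f : MvPolynomial (Fin n) ℂ) : Ideal (MvPolynomial (Fin n) ℂ) where
  carrier := {φ | apolarAction φ f = 0}
  zero_mem' := by simp [apolarAction]
  add_mem' := by
    intro φ ψ hφ hψ
    simp only [Set.mem_ofPred_eq, ← apolarHom_apply] at hφ hψ ⊢
    simp [hφ, hψ]
  smul_mem' := by
    intro φ ψ hψ
    simp only [Set.mem_ofPred_eq, ← apolarHom_apply] at hψ ⊢
    simp [hψ]

/-- The Laplace operator `Δ = ∑ i, ∂ ^ 2 / ∂x_i ^ 2` on `ℂ[x_1, …, x_n]`. -/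
def laplacian (n : ℕ) : Module.End ℂ (MvPolynomial (Fin n) ℂ) :=
  ∑ i, (pderiv i).toLinearMap ^ 2

/-- The space `H_{n,d}` of harmonic polynomials of degree `d`: the forms of degree `d` in `n`
variables that are killed by the Laplace operator. -/
def harmonic (n d : ℕ) : Submodule ℂ (MvPolynomial (Fin n) ℂ) :=
  homogeneousSubmodule (Fin n) ℂ d ⊓ LinearMap.ker (laplacian n)

end Apolarity

end

namespace Apolarity

open MvPolynomial

variable {n : ℕ}

/-! Everything rests on one formula: a harmonic `h` of degree `d` acts on `q_n ^ (d + m)` as `c q_n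
^ m h` with `c ≠ 0`. Applied to the derivatives of `h ∈ H_{n,s+1}`, Euler's identity turns `h ∘ q_n
^ s` into a multiple of `Δ h = 0`, which gives one inclusion.

For the other, induct on `s`: `Ann(q_n ^ (s + 1)) ⊆ Ann(q_n ^ s) ⊆ (H_{n,s+1})`. So it suffices to
treat `φ ∈ (H_{n,s})` that kills `q_n ^ s`. Modulo `(H_{n,s+1})` such a `φ` is `∑ q_n ^ (s - j) h_j`
with `h_j ∈ H_{n,j}`. Since `q_n` acts as `Δ`, this sum sends `q_n ^ s` to `∑ c_j h_j` with all `c_j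
≠ 0`. The degrees differ, so every `h_j` vanishes. -/

theorem apolarHom_X (i : Fin n) : apolarHom n (X i) = (pderiv i).toLinearMap := by
  have h : apolarHom n (X i) = iteratedPartial (Finsupp.single i 1) := by
    refine LinearMap.ext fun f => ?_
    rw [apolarHom_apply, apolarAction, support_X, Finset.sum_singleton, coeff_X, if_pos rfl,
      one_smul]
  rw [h, iteratedPartial]
  refine (Finset.noncommProd_congr (Finset.insert_erase (Finset.mem_univ i)).symm
    (fun _ _ => rfl) _).trans
    ((Finset.noncommProd_insert_of_notMem _ _ _ _ (Finset.notMem_erase i _)).trans ?_)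
  rw [Finset.noncommProd_eq_pow_card _ _ _ 1 fun j hj => by
    rw [Finsupp.single_eq_of_ne (Finset.ne_of_mem_erase hj), pow_zero]]
  simp

theorem apolarHom_quadric : apolarHom n (quadric n) = laplacian n := by
  simp [quadric, laplacian, apolarHom_X]

/-! ### The Laplacian on products with powers of the quadric -/

theorem laplacian_apply (f : MvPolynomial (Fin n) ℂ) :
    laplacian n f = ∑ i, pderiv i (pderiv i f) := by
  simp [laplacian, pow_two]

theorem laplacian_pderiv (i : Fin n) (f : MvPolynomial (Fin n) ℂ) :
    laplacian n (pderiv i f) = pderiv i (laplacian n f) := by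
  have h : Commute (laplacian n) (pderiv i).toLinearMap :=
    Commute.sum_left _ _ _ fun j _ => (commute_pderiv n j i).pow_left 2
  exact LinearMap.congr_fun h f

theorem laplacian_mul (f g : MvPolynomial (Fin n) ℂ) :
    laplacian n (f * g) =
      laplacian n f * g + 2 * ∑ i, pderiv i f * pderiv i g + f * laplacian n g := by
  simp only [laplacian_apply, Finset.sum_mul, Finset.mul_sum, ← Finset.sum_add_distrib]
  refine Finset.sum_congr rfl fun i _ => ?_
  simp only [Derivation.leibniz, map_add, smul_eq_mul]
  ring

theorem pderiv_quadric (i : Fin n) : pderiv i (quadric n) = 2 * X i := by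
  simp [quadric, pderiv_X, Pi.single_apply, Derivation.leibniz_pow]

theorem laplacian_quadric : laplacian n (quadric n) = C (2 * n : ℂ) := by
  have h (i : Fin n) : pderiv i (2 * X i : MvPolynomial (Fin n) ℂ) = 2 := by
    rw [show (2 : MvPolynomial (Fin n) ℂ) = C 2 from (map_ofNat C 2).symm, pderiv_C_mul]
    simp
  simp only [laplacian_apply, pderiv_quadric, h]
  simp only [Finset.sum_const, Finset.card_univ, Fintype.card_fin, nsmul_eq_mul, map_mul,
    map_natCast, map_ofNat, mul_comm]

theorem quadric_isHomogeneous : (quadric n).IsHomogeneous 2 :=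
  IsHomogeneous.sum _ _ _ fun i _ => by simpa using (isHomogeneous_X ℂ i).pow 2

theorem mem_harmonic {d : ℕ} {h : MvPolynomial (Fin n) ℂ} :
    h ∈ harmonic n d ↔ h.IsHomogeneous d ∧ laplacian n h = 0 := by
  simp [harmonic]

theorem pderiv_mem_harmonic {d : ℕ} {h : MvPolynomial (Fin n) ℂ} (hh : h ∈ harmonic n (d + 1))
    (i : Fin n) : pderiv i h ∈ harmonic n d := by
  rw [mem_harmonic] at hh ⊢
  exact ⟨hh.1.pderiv, by rw [laplacian_pderiv, hh.2, map_zero]⟩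

theorem pderiv_eq_zero_of_mem_harmonic_zero {h : MvPolynomial (Fin n) ℂ}
    (hh : h ∈ harmonic n 0) (i : Fin n) : pderiv i h = 0 := by
  have h0 := (mem_harmonic.1 hh).1
  rw [← totalDegree_zero_iff_isHomogeneous, totalDegree_eq_zero_iff_eq_C] at h0
  rw [h0, pderiv_C]

theorem laplacian_quadric_mul {d : ℕ} {f : MvPolynomial (Fin n) ℂ} (hf : f.IsHomogeneous d) :
    laplacian n (quadric n * f) = C (2 * n + 4 * d : ℂ) * f + quadric n * laplacian n f := by
  have h := hf.sum_X_mul_pderiv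
  simp only [laplacian_mul, laplacian_quadric, pderiv_quadric, mul_assoc, ← Finset.mul_sum, h]
  simp only [nsmul_eq_mul, map_add, map_mul, map_natCast, map_ofNat]
  ring

theorem laplacian_quadric_pow_succ_mul {d : ℕ} {h : MvPolynomial (Fin n) ℂ}
    (hh : h ∈ harmonic n d) (m : ℕ) :
    laplacian n (quadric n ^ (m + 1) * h) =
      C (2 * (m + 1) * (2 * m + 2 * d + n) : ℂ) * (quadric n ^ m * h) := by
  rw [mem_harmonic] at hh
  induction m with
  | zero =>
    simp only [zero_add, pow_one, pow_zero, one_mul, laplacian_quadric_mul hh.1, hh.2,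
      Nat.cast_zero]
    rw [mul_zero, add_zero]
    congr 2
    ring
  | succ m ih =>
    rw [pow_succ', mul_assoc, laplacian_quadric_mul ((quadric_isHomogeneous.pow (m + 1)).mul hh.1),
      ih, pow_succ']
    simp only [map_add, map_mul, map_natCast, map_ofNat, map_one, Nat.cast_add, Nat.cast_mul,
      Nat.cast_one, Nat.cast_ofNat]
    ring

theorem laplacian_pow_quadric_pow_mul (hn : 0 < n) (d m : ℕ) :
    ∃ c : ℂ, c ≠ 0 ∧ ∀ h ∈ harmonic n d, (laplacian n ^ m) (quadric n ^ m * h) = C c * h := by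
  induction m with
  | zero => exact ⟨1, one_ne_zero, by simp⟩
  | succ m ih =>
    obtain ⟨c, hc, H⟩ := ih
    refine ⟨2 * (m + 1) * (2 * m + 2 * d + n) * c, mul_ne_zero ?_ hc, fun h hh => ?_⟩
    · norm_cast
      positivity
    · rw [pow_succ, Module.End.mul_apply, laplacian_quadric_pow_succ_mul hh, ← smul_eq_C_mul,
        map_smul, H h hh, smul_eq_C_mul, ← mul_assoc, ← C_mul]

/-! ### Harmonic operators acting on powers of the quadric -/

/-- Euler's identity for `h`, read as an identity of operators; it allows induction on the degree
through the derivatives of `h`. -/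
theorem succ_smul_apolarHom {d : ℕ} {h : MvPolynomial (Fin n) ℂ} (hh : h.IsHomogeneous (d + 1))
    (f : MvPolynomial (Fin n) ℂ) :
    C ((d : ℂ) + 1) * apolarHom n h f = ∑ i, pderiv i (apolarHom n (pderiv i h) f) := by
  have h1 := congrArg (fun φ => apolarHom n φ f) hh.sum_X_mul_pderiv
  simp only [map_sum, map_mul, apolarHom_X, LinearMap.sum_apply, Module.End.mul_apply,
    map_nsmul, LinearMap.smul_apply] at h1
  rw [nsmul_eq_mul] at h1
  simpa using h1.symm

theorem apolarHom_harmonic_quadric_pow (d m : ℕ) :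
    ∃ c : ℂ, c ≠ 0 ∧ ∀ h ∈ harmonic n d,
      apolarHom n h (quadric n ^ (d + m)) = C c * (quadric n ^ m * h) := by
  induction d generalizing m with
  | zero =>
    refine ⟨1, one_ne_zero, fun h hh => ?_⟩
    have h0 := (mem_harmonic.1 hh).1
    rw [← totalDegree_zero_iff_isHomogeneous, totalDegree_eq_zero_iff_eq_C] at h0
    rw [h0, ← algebraMap_eq, AlgHom.commutes, Module.algebraMap_end_apply, algebraMap_eq,
      smul_eq_C_mul, zero_add]
    simp [mul_comm]
  | succ d ih =>
    obtain ⟨c, hc, H⟩ := ih (m + 1)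
    refine ⟨2 * (m + 1) * c, mul_ne_zero (by norm_cast) hc, fun h hh => ?_⟩
    have hd : (C ((d : ℂ) + 1) : MvPolynomial (Fin n) ℂ) ≠ 0 := by
      rw [Ne, C_eq_zero]
      norm_cast
    have hL := (mem_harmonic.1 hh).2
    have hE := (mem_harmonic.1 hh).1.sum_X_mul_pderiv
    rw [laplacian_apply] at hL
    apply mul_left_cancel₀ hd
    rw [succ_smul_apolarHom (mem_harmonic.1 hh).1, show d + 1 + m = d + (m + 1) by ring]
    have hi (i : Fin n) : pderiv i (apolarHom n (pderiv i h) (quadric n ^ (d + (m + 1)))) =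
        C c * quadric n ^ (m + 1) * pderiv i (pderiv i h) +
          C c * ((m : MvPolynomial (Fin n) ℂ) + 1) * quadric n ^ m * 2 * (X i * pderiv i h) := by
      rw [H _ (pderiv_mem_harmonic hh i), pderiv_C_mul, pderiv_mul, pderiv_pow, pderiv_quadric]
      push_cast
      ring
    -- Summing over `i`, the first terms give `Δ h = 0`, and Euler's identity gives the factor `d +
    -- 1` to be cancelled.
    simp only [hi, Finset.sum_add_distrib, ← Finset.mul_sum, hL, hE]
    simp only [nsmul_eq_mul, map_add, map_mul, map_natCast, map_ofNat, map_one, Nat.cast_add,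
      Nat.cast_one]
    ring

theorem apolarHom_harmonic_succ_quadric_pow {s : ℕ} {h : MvPolynomial (Fin n) ℂ}
    (hh : h ∈ harmonic n (s + 1)) : apolarHom n h (quadric n ^ s) = 0 := by
  obtain ⟨c, -, H⟩ := apolarHom_harmonic_quadric_pow (n := n) s 0
  have hs : (C ((s : ℂ) + 1) : MvPolynomial (Fin n) ℂ) ≠ 0 := by
    rw [Ne, C_eq_zero]
    norm_cast
  have hi (i : Fin n) : apolarHom n (pderiv i h) (quadric n ^ s) = C c * pderiv i h := by
    simpa using H _ (pderiv_mem_harmonic hh i)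
  have hL := (mem_harmonic.1 hh).2
  rw [laplacian_apply] at hL
  apply mul_left_cancel₀ hs
  simp only [succ_smul_apolarHom (mem_harmonic.1 hh).1, hi, pderiv_C_mul, ← Finset.mul_sum,
    hL, mul_zero]

/-! ### Ideals generated by harmonic polynomials -/

/-- For `n = 2` and `d = 0` the coefficient is `0⁻¹ = 0`, and the derivatives of `h` vanish. -/
theorem X_mul_sub_mem_harmonic (hn : 2 ≤ n) {d : ℕ} {h : MvPolynomial (Fin n) ℂ}
    (hh : h ∈ harmonic n d) (i : Fin n) :
    X i * h - C ((n + 2 * d - 2 : ℂ)⁻¹) * (quadric n * pderiv i h) ∈ harmonic n (d + 1) := by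
  have hX : laplacian n (X i * h) = 2 * pderiv i h := by
    rw [laplacian_mul, (mem_harmonic.1 hh).2]
    simp [laplacian_apply, pderiv_X, Pi.single_apply, apply_ite]
  have hX' : (X i * h).IsHomogeneous (d + 1) := by
    rw [add_comm]
    exact (isHomogeneous_X ℂ i).mul (mem_harmonic.1 hh).1
  cases d with
  | zero =>
    rw [pderiv_eq_zero_of_mem_harmonic_zero hh] at hX ⊢
    rw [mul_zero, mul_zero, sub_zero, mem_harmonic]
    exact ⟨hX', by rw [hX, mul_zero]⟩
  | succ d =>
    have hp := mem_harmonic.1 (pderiv_mem_harmonic hh i)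
    rw [mem_harmonic]
    constructor
    · refine hX'.sub ?_
      rw [show d + 1 + 1 = 0 + (2 + d) by ring]
      exact (isHomogeneous_C _ _).mul (quadric_isHomogeneous.mul hp.1)
    · have hne : (n + 2 * (d + 1 : ℕ) - 2 : ℂ) ≠ 0 := by
        have : (n + 2 * (d + 1 : ℕ) - 2 : ℂ) = ((n + 2 * d : ℕ) : ℂ) := by push_cast; ring
        rw [this, Nat.cast_ne_zero]
        omega
      -- The coefficient balances `Δ(x_i h) = 2 ∂_i h` against `Δ(q_n ∂_i h) = (2n + 4d) ∂_i h`,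
      -- where `d` is now the degree of `∂_i h`.
      rw [map_sub, ← smul_eq_C_mul, map_smul, hX, laplacian_quadric_mul hp.1, hp.2, mul_zero,
        add_zero, smul_eq_C_mul, ← mul_assoc, ← C_mul,
        show (2 * n + 4 * d : ℂ) = (n + 2 * (d + 1 : ℕ) - 2) * 2 by push_cast; ring,
        inv_mul_cancel_left₀ hne, map_ofNat, sub_self]

/-- Multiply the harmonic projection of `x_i h` by `x_i` and sum: Euler's identity leaves `(1 - a d)
q_n h`, and `n + 2d - 2 ≠ d` for `d > 0`. -/
theorem quadric_mul_mem_span_harmonic (hn : 2 ≤ n) {d : ℕ} {h : MvPolynomial (Fin n) ℂ}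
    (hh : h ∈ harmonic n d) :
    quadric n * h ∈ Ideal.span (harmonic n (d + 1) : Set (MvPolynomial (Fin n) ℂ)) := by
  set a : ℂ := (n + 2 * d - 2 : ℂ)⁻¹ with ha
  have hsum : ∑ i, X i * (X i * h - C a * (quadric n * pderiv i h)) =
      C (1 - a * d) * (quadric n * h) := by
    have hE := (mem_harmonic.1 hh).1.sum_X_mul_pderiv
    have hi (i : Fin n) : X i * (X i * h - C a * (quadric n * pderiv i h)) =
        X i ^ 2 * h - C a * quadric n * (X i * pderiv i h) := by ring
    simp only [hi, Finset.sum_sub_distrib, ← Finset.mul_sum, ← Finset.sum_mul, hE]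
    rw [← quadric, nsmul_eq_mul]
    simp only [map_sub, map_mul, map_one, map_natCast]
    ring
  have hne : 1 - a * d ≠ 0 := by
    rcases Nat.eq_zero_or_pos d with rfl | hd
    · simp
    · obtain ⟨k, rfl⟩ := Nat.exists_eq_add_of_le hn
      have h1 : ((2 + k : ℕ) + 2 * d - 2 : ℂ) = ((k + 2 * d : ℕ) : ℂ) := by push_cast; ring
      have h2 : ((k + 2 * d : ℕ) : ℂ) ≠ 0 := by
        rw [Nat.cast_ne_zero]
        omega
      rw [ha, h1, sub_ne_zero]
      intro h3
      rw [eq_inv_mul_iff_mul_eq₀ h2, mul_one, Nat.cast_inj] at h3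
      omega
  have hmem : C (1 - a * d) * (quadric n * h) ∈
      Ideal.span (harmonic n (d + 1) : Set (MvPolynomial (Fin n) ℂ)) := by
    rw [← hsum]
    exact Ideal.sum_mem _ fun i _ => Ideal.mul_mem_left _ _
      (Ideal.subset_span (X_mul_sub_mem_harmonic hn hh i))
  have := Ideal.mul_mem_left _ (C (1 - a * d)⁻¹) hmem
  rwa [← mul_assoc, ← C_mul, inv_mul_cancel₀ hne, C_1, one_mul] at this

theorem quadric_pow_mul_mem_span_harmonic (hn : 2 ≤ n) (m : ℕ) {d : ℕ}
    {h : MvPolynomial (Fin n) ℂ} (hh : h ∈ harmonic n d) :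
    quadric n ^ m * h ∈ Ideal.span (harmonic n (d + m) : Set (MvPolynomial (Fin n) ℂ)) := by
  induction m with
  | zero => simpa using Ideal.subset_span hh
  | succ m ih =>
    rw [pow_succ', mul_assoc]
    refine Submodule.span_induction (fun x hx => ?_) ?_ (fun x y _ _ hx hy => ?_)
      (fun r x _ hx => ?_) ih
    · exact quadric_mul_mem_span_harmonic hn hx
    · simp
    · rw [mul_add]
      exact add_mem hx hy
    · rw [smul_eq_mul, mul_left_comm]
      exact Ideal.mul_mem_left _ _ hx

/-- Modulo the ideal generated by `H_{n,s+1}`, every element of the ideal generated by `H_{n,s}`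
is a sum of products `q_n ^ (s - j) h_j` with `h_j` harmonic of degree `j`. -/
theorem exists_sub_sum_mem_span_harmonic (hn : 2 ≤ n) {s : ℕ} {φ : MvPolynomial (Fin n) ℂ}
    (hφ : φ ∈ Ideal.span (harmonic n s : Set (MvPolynomial (Fin n) ℂ))) :
    ∃ h : ℕ → MvPolynomial (Fin n) ℂ, (∀ j, h j ∈ harmonic n j) ∧
      φ - ∑ j ∈ Finset.range (s + 1), quadric n ^ (s - j) * h j ∈
        Ideal.span (harmonic n (s + 1) : Set (MvPolynomial (Fin n) ℂ)) := by
  have add_aux {φ ψ : MvPolynomial (Fin n) ℂ}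
      (hφ : ∃ h : ℕ → MvPolynomial (Fin n) ℂ, (∀ j, h j ∈ harmonic n j) ∧
        φ - ∑ j ∈ Finset.range (s + 1), quadric n ^ (s - j) * h j ∈
          Ideal.span (harmonic n (s + 1) : Set (MvPolynomial (Fin n) ℂ)))
      (hψ : ∃ h : ℕ → MvPolynomial (Fin n) ℂ, (∀ j, h j ∈ harmonic n j) ∧
        ψ - ∑ j ∈ Finset.range (s + 1), quadric n ^ (s - j) * h j ∈
          Ideal.span (harmonic n (s + 1) : Set (MvPolynomial (Fin n) ℂ))) :
      ∃ h : ℕ → MvPolynomial (Fin n) ℂ, (∀ j, h j ∈ harmonic n j) ∧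
        φ + ψ - ∑ j ∈ Finset.range (s + 1), quadric n ^ (s - j) * h j ∈
          Ideal.span (harmonic n (s + 1) : Set (MvPolynomial (Fin n) ℂ)) := by
    obtain ⟨g, hg, hφg⟩ := hφ
    obtain ⟨h, hh, hψh⟩ := hψ
    refine ⟨g + h, fun j => add_mem (hg j) (hh j), ?_⟩
    convert add_mem hφg hψh using 1
    simp only [Pi.add_apply, mul_add, Finset.sum_add_distrib]
    ring
  refine Submodule.span_induction (fun x hx => ?_) ?_ (fun x y _ _ hx hy => add_aux hx hy)
      (fun r x _ hx => ?_) hφ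
  · refine ⟨Pi.single s x, fun j => ?_, ?_⟩
    · rcases eq_or_ne j s with rfl | hj
      · simpa using hx
      · simp [hj]
    · rw [Finset.sum_range_succ, Finset.sum_eq_zero fun j hj => by
        simp [(Finset.mem_range.1 hj).ne]]
      simp
  · exact ⟨0, fun j => zero_mem _, by simp⟩
  · rw [smul_eq_mul]
    induction r using MvPolynomial.induction_on generalizing x with
    | C a =>
      obtain ⟨h, hh, hx⟩ := hx
      refine ⟨a • h, fun j => Submodule.smul_mem _ a (hh j), ?_⟩
      convert Ideal.mul_mem_left _ (C a) hx using 1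
      simp only [Pi.smul_apply, smul_eq_C_mul, mul_sub, Finset.mul_sum]
      simp only [mul_left_comm]
    | add p q hp hq =>
      rw [add_mul]
      exact add_aux (hp x ‹_› hx) (hq x ‹_› hx)
    | mul_X p i hp =>
      rw [mul_assoc]
      refine hp (X i * x) (Ideal.mul_mem_left _ _ ‹_›) ?_
      obtain ⟨h, hh, hx⟩ := hx
      let a (j : ℕ) : ℂ := (n + 2 * j - 2 : ℂ)⁻¹
      -- The correction term of `x_i h_j` has one more factor `q_n` and a harmonic factor of degree
      -- `j - 1`, so it moves to index `j - 1`. Nothing moves into index `s`, and nothing is lost at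
      -- `j = 0`, where `∂_i h_0 = 0`.
      refine ⟨fun j => if j < s then C (a (j + 1)) * pderiv i (h (j + 1)) else 0,
        fun j => ?_, ?_⟩
      · dsimp only
        split_ifs
        · rw [← smul_eq_C_mul]
          exact Submodule.smul_mem _ _ (pderiv_mem_harmonic (hh (j + 1)) i)
        · exact zero_mem _
      · have hsum : ∑ j ∈ Finset.range (s + 1), quadric n ^ (s - j) *
            (if j < s then C (a (j + 1)) * pderiv i (h (j + 1)) else 0) =
            ∑ j ∈ Finset.range (s + 1),
              quadric n ^ (s - j) * (C (a j) * (quadric n * pderiv i (h j))) := by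
          rw [Finset.sum_range_succ, Finset.sum_range_succ',
            pderiv_eq_zero_of_mem_harmonic_zero (hh 0)]
          simp only [lt_irrefl, if_false, mul_zero, add_zero]
          refine Finset.sum_congr rfl fun j hj => ?_
          have hj := Finset.mem_range.1 hj
          rw [if_pos hj, show s - j = s - (j + 1) + 1 by omega, pow_succ]
          ring
        have hmem : ∑ j ∈ Finset.range (s + 1), quadric n ^ (s - j) *
            (X i * h j - C (a j) * (quadric n * pderiv i (h j))) ∈
              Ideal.span (harmonic n (s + 1) : Set (MvPolynomial (Fin n) ℂ)) := by
          refine Ideal.sum_mem _ fun j hj => ?_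
          have hj := Finset.mem_range.1 hj
          have := quadric_pow_mul_mem_span_harmonic hn (s - j)
            (X_mul_sub_mem_harmonic hn (hh j) i)
          rwa [show j + 1 + (s - j) = s + 1 by omega] at this
        convert add_mem (Ideal.mul_mem_left _ (X i) hx) hmem using 1
        rw [hsum]
        simp only [mul_sub, Finset.sum_sub_distrib, Finset.mul_sum, mul_left_comm (X i)]
        ring

/-! ### The apolar ideal lies in the harmonic ideal -/

theorem mem_span_harmonic_succ (hn : 2 ≤ n) {s : ℕ} {φ : MvPolynomial (Fin n) ℂ}
    (hφ : φ ∈ Ideal.span (harmonic n s : Set (MvPolynomial (Fin n) ℂ)))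
    (h0 : φ ∈ apolarIdeal (quadric n ^ s))
    (hle : Ideal.span (harmonic n (s + 1) : Set (MvPolynomial (Fin n) ℂ)) ≤
      apolarIdeal (quadric n ^ s)) :
    φ ∈ Ideal.span (harmonic n (s + 1) : Set (MvPolynomial (Fin n) ℂ)) := by
  obtain ⟨h, hh, hsub⟩ := exists_sub_sum_mem_span_harmonic hn hφ
  have hact : apolarHom n (∑ j ∈ Finset.range (s + 1), quadric n ^ (s - j) * h j)
      (quadric n ^ s) = 0 := by
    rw [apolarHom_apply]
    have := Ideal.sub_mem _ h0 (hle hsub)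
    rwa [sub_sub_cancel] at this
  -- First `h_j` sends `q_n ^ s` to a multiple of `q_n ^ (s - j) h_j`; then `Δ ^ (s - j)` strips off
  -- the power of `q_n`.
  have key (j : ℕ) : ∃ c : ℂ, c ≠ 0 ∧ (j ∈ Finset.range (s + 1) →
      apolarHom n (quadric n ^ (s - j) * h j) (quadric n ^ s) = C c * h j) := by
    obtain ⟨c, hc, H⟩ := apolarHom_harmonic_quadric_pow (n := n) j (s - j)
    obtain ⟨c', hc', H'⟩ := laplacian_pow_quadric_pow_mul (n := n) (by omega) j (s - j)
    refine ⟨c * c', mul_ne_zero hc hc', fun hj => ?_⟩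
    have hj := Finset.mem_range.1 hj
    have := H _ (hh j)
    rw [show j + (s - j) = s by omega] at this
    rw [map_mul, map_pow (apolarHom n), apolarHom_quadric, Module.End.mul_apply, this, ← smul_eq_C_mul,
      map_smul, H' _ (hh j), smul_eq_C_mul, C_mul, mul_assoc]
  choose c hc H using key
  rw [map_sum, LinearMap.sum_apply, Finset.sum_congr rfl H] at hact
  have hzero (k : ℕ) (hk : k ∈ Finset.range (s + 1)) : h k = 0 := by
    have h1 := congrArg (homogeneousComponent k) hact
    rw [map_sum, map_zero, Finset.sum_eq_single_of_mem k hk] at h1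
    · rw [homogeneousComponent_C_mul, homogeneousComponent_eq_self (mem_harmonic.1 (hh k)).1] at h1
      exact (mul_eq_zero.1 h1).resolve_left (by simpa using hc k)
    · intro j _ hjk
      rw [homogeneousComponent_C_mul, homogeneousComponent_of_mem (mem_harmonic.1 (hh j)).1,
        if_neg hjk.symm, mul_zero]
  rwa [Finset.sum_eq_zero fun j hj => by rw [hzero j hj, mul_zero], sub_zero] at hsub

/-- Apolar operators commute with `Δ`, and `Δ q_n ^ (s + 1)` is a nonzero multiple of `q_n ^ s`. -/
theorem apolarIdeal_quadric_pow_succ_le (hn : 0 < n) (s : ℕ) :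
    apolarIdeal (quadric n ^ (s + 1)) ≤ apolarIdeal (quadric n ^ s) := by
  intro φ hφ
  change apolarAction φ _ = 0 at hφ
  change apolarAction φ _ = 0
  rw [← apolarHom_apply] at hφ ⊢
  have h1 : (1 : MvPolynomial (Fin n) ℂ) ∈ harmonic n 0 :=
    mem_harmonic.2 ⟨isHomogeneous_one _ _, by simp [laplacian_apply]⟩
  have h2 := laplacian_quadric_pow_succ_mul h1 s
  rw [mul_one, mul_one, ← smul_eq_C_mul] at h2
  have h3 : apolarHom n φ (laplacian n (quadric n ^ (s + 1))) = 0 := by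
    rw [← apolarHom_quadric, ← Module.End.mul_apply, ← map_mul, mul_comm, map_mul,
      Module.End.mul_apply, hφ, map_zero]
  rw [h2, map_smul] at h3
  refine (smul_eq_zero.1 h3).resolve_left ?_
  norm_cast
  positivity

theorem span_harmonic_le_apolarIdeal (s : ℕ) :
    Ideal.span (harmonic n (s + 1) : Set (MvPolynomial (Fin n) ℂ)) ≤
      apolarIdeal (quadric n ^ s) :=
  Ideal.span_le.2 fun h hh =>
    (apolarHom_apply h _).symm.trans (apolarHom_harmonic_succ_quadric_pow hh)

theorem apolarIdeal_quadric_pow_le (hn : 2 ≤ n) (s : ℕ) :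
    apolarIdeal (quadric n ^ s) ≤
      Ideal.span (harmonic n (s + 1) : Set (MvPolynomial (Fin n) ℂ)) := by
  induction s with
  | zero =>
    intro φ hφ
    -- Since `1 ∈ H_{n,0}`, the ideal `(H_{n,0})` is the whole ring, and membership of `φ` is
    -- automatic.
    refine mem_span_harmonic_succ hn ?_ hφ (span_harmonic_le_apolarIdeal 0)
    have h1 : (1 : MvPolynomial (Fin n) ℂ) ∈ harmonic n 0 :=
      mem_harmonic.2 ⟨isHomogeneous_one _ _, by simp [laplacian_apply]⟩
    simpa using Ideal.mul_mem_left _ φ (Ideal.subset_span h1)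
  | succ s ih =>
    intro φ hφ
    exact mem_span_harmonic_succ hn (ih (apolarIdeal_quadric_pow_succ_le (by omega) s hφ)) hφ
      (span_harmonic_le_apolarIdeal (s + 1))

end Apolarity

/-- For `n ≥ 2`, the apolar ideal of `q_n ^ s` is generated by the harmonic polynomials of degree
`s + 1`. -/
theorem mainTheorem1 (n s : ℕ) (hn : 2 ≤ n) :
    Apolarity.apolarIdeal (Apolarity.quadric n ^ s) =
      Ideal.span (Apolarity.harmonic n (s + 1) : Set (MvPolynomial (Fin n) ℂ)) :=
  le_antisymm (Apolarity.apolarIdeal_quadric_pow_le hn s)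
    (Apolarity.span_harmonic_le_apolarIdeal s)
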